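/- Let $R$ and $S$ be (not necessarily commutative) rings that are Noetherian on both sides, and let $l\colon R\to S$ be a unital ring homomorphism; regard $S$ as an $R$-$R$-bimodule, and $S$-modules as $R$-modules, via $l$. All modules are left modules unless stated otherwise. Assume: (i) $S/R$ is a Frobenius extension: ${}_RS$ is a finitely generated projective $R$-module and ${}_SS_R\cong \mathrm{Hom}_R({}_RS_S,{}_RR_R)$ as $S$-$R$-bimodules; (ii) ${}_RS_R$ is centrally projective over $R$: as an $R$-$R$-bimodule, $S$ is isomorphic to a direct summand of $R^n$ for some $n\ge 0$; (iii) $\omega$ is a Wakamatsu tilting $R$-module: $\omega$ is a finitely generated $R$-module and, with $T=\mathrm{End}_R(\omega)$ acting on $\omega$ from the right, the natural map $R\to\mathrm{End}_{T^{\mathrm{op}}}(\omega)$ is an isomorphism and $\mathrm{Ext}^i_R(\omega,\omega)=0=\mathrm{Ext}^i_{T^{\mathrm{op}}}(\omega,\omega)$ for all $i\ge 1$. For a ring $A$, an $A$-module $W$ with $E=\mathrm{End}_A(W)$ acting on the right, and an $A$-module $N$, write $N^W=\mathrm{Hom}_A(N,W)$, a right $E$-module. We say that $N$ has *generalized G-dimension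 zero with respect to $W$* if $N$ is finitely generated, the evaluation map $N\to\mathrm{Hom}_{E^{\mathrm{op}}}(N^W,W)$, $x\mapsto(f\mapsto f(x))$, is bijective, and $\mathrm{Ext}^i_A(N,W)=0=\mathrm{Ext}^i_{E^{\mathrm{op}}}(N^W,W)$ for all $i\ge 1$. **Theorem 5.6.** Let $M$ be an $S$-module. Then $M$ has generalized G-dimension zero with respect to the $S$-module $S\otimes_R\omega$ if and only if the underlying $R$-module of $M$ has generalized G-dimension zero with respect to $\omega$. -/

import Mathlib

open scoped TensorProduct

universe u

/-- A ring that is Noetherian on both sides. -/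
def IsTwoSidedNoetherian (R : Type u) [Ring R] : Prop :=
  IsNoetherianRing R ∧ IsNoetherianRing Rᵐᵒᵖ

/-- The ring extension `l : R → S` is a Frobenius extension: `S` is finitely generated projective
as a left `R`-module, and `S ≅ Hom_R(S, R)` as `S`-`R`-bimodules, where `Hom_R(S, R)` consists of
the left `R`-linear maps and `(s • f • r)(x) = f (x * s) * r`. -/
def IsFrobeniusExtension {R S : Type u} [Ring R] [Ring S] (l : R →+* S) : Prop :=
  letI : Module R S := Module.compHom S l
  Module.Finite R S ∧ Module.Projective R S ∧
    ∃ φ : S ≃+ (S →ₗ[R] R),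
      (∀ s t x : S, φ (s * t) x = φ t (x * s)) ∧
      (∀ (t : S) (r : R) (x : S), φ (t * l r) x = φ t x * r)

/-- The `R`-`R`-bimodule `S` is centrally projective over `R`: it is isomorphic to a direct summand
of some `Rⁿ` as a bimodule, i.e. it is a retract of `Rⁿ` by bimodule homomorphisms. -/
def IsCentrallyProjective {R S : Type u} [Ring R] [Ring S] (l : R →+* S) : Prop :=
  ∃ (n : ℕ) (i : S →+ (Fin n → R)) (p : (Fin n → R) →+ S),
    (∀ (a b : R) (s : S) (j : Fin n), i (l a * s * l b) j = a * i s j * b) ∧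
    (∀ (a b : R) (v : Fin n → R), p (fun j => a * v j * b) = l a * p v * l b) ∧
    ∀ s : S, p (i s) = s

/-- The left `S`-module `S ⊗_R W` for a ring homomorphism `l : R → S` of not necessarily commutative
rings and a left `R`-module `W`: the quotient of `S ⊗_ℤ W` by the relations
`s l(r) ⊗ w = s ⊗ r w`. (The set of relations is stable under left multiplication by `S`, so its
`S`-span is its additive span.) -/
abbrev ExtensionOfScalars {R S : Type u} [Ring R] [Ring S] (l : R →+* S)
    (W : Type u) [AddCommGroup W] [Module R W] : Type u :=
  (S ⊗[ℤ] W) ⧸ Submodule.span S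
    {x : S ⊗[ℤ] W | ∃ (s : S) (r : R) (w : W), x = (s * l r) ⊗ₜ[ℤ] w - s ⊗ₜ[ℤ] (r • w)}

/-- `Ext^i_A(M, N) = 0` for all `i ≥ 1`, for left modules over a ring `A`. -/
def ExtVanishes (A : Type u) [Ring A] (M N : Type u) [AddCommGroup M] [Module A M]
    [AddCommGroup N] [Module A N] : Prop :=
  ∀ i : ℕ, 1 ≤ i →
    Subsingleton (CategoryTheory.Abelian.Ext (ModuleCat.of A M) (ModuleCat.of A N) i)

/-- The evaluation map `σ_M : M → M^{ωω}`, `σ_M(m)(f) = f(m)`. Here `Module.End R W` is the ring of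
`R`-endomorphisms of `W` with multiplication `(f * g)(w) = f (g w)`, acting on `W` from the left;
it is the opposite of the endomorphism ring `T` acting from the right, so right `T`-modules are left
`Module.End R W`-modules, and `M^ω = Hom_R(M, W)` is one by composition. -/
def evaluationMap (R : Type u) [Ring R] (W M : Type u) [AddCommGroup W] [Module R W]
    [AddCommGroup M] [Module R M] :
    M →ₗ[R] ((M →ₗ[R] W) →ₗ[Module.End R W] W) where
  toFun m :=
    { toFun := fun f => f m
      map_add' := fun _ _ => rfl
      map_smul' := fun _ _ => rfl }
  map_add' m m' := by ext f; exact map_add f m m'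
  map_smul' r m := by ext f; exact map_smul f r m

/-- `W` is a Wakamatsu tilting `R`-module: it is finitely generated, and `_R W_T` with
`T = End(_R W)` is a faithful balanced self-orthogonal bimodule, i.e. the natural map
`R → End_{T^op}(W)` is an isomorphism and `Ext^i_R(W, W) = 0 = Ext^i_{T^op}(W, W)` for `i ≥ 1`. -/
structure IsWakamatsuTilting (R : Type u) [Ring R] (W : Type u) [AddCommGroup W] [Module R W] :
    Prop where
  finite : Module.Finite R W
  balanced : Function.Bijective
    (Module.toModuleEnd (Module.End R W) (S := R) W : R → Module.End (Module.End R W) W)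
  ext_left : ExtVanishes R W W
  ext_right : ExtVanishes (Module.End R W) W W

/-- `M` has generalized G-dimension zero with respect to `W`: it is finitely generated and
`W`-reflexive, and `Ext^i_R(M, W) = 0 = Ext^i_{T^op}(M^W, W)` for all `i ≥ 1`, where
`T = End(_R W)` and `M^W = Hom_R(M, W)`. -/
structure HasGeneralizedGDimZero (R : Type u) [Ring R] (W : Type u) [AddCommGroup W] [Module R W]
    (M : Type u) [AddCommGroup M] [Module R M] : Prop where
  finite : Module.Finite R M
  reflexive : Function.Bijective (evaluationMap R W M)
  ext_left : ExtVanishes R M W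
  ext_right : ExtVanishes (Module.End R W) (M →ₗ[R] W) W

/-!
The proof rests on coinduced modules. For a Frobenius extension `R → S` with Frobenius homomorphism
`tr : S → R`, the module `ω' = S ⊗_R ω` is isomorphic to `Hom_R(S, ω)`, with counit
`τ : ω' → ω`, `s ⊗ w ↦ tr(s) w` (`ExtensionOfScalars.exists_isCoinduced`). Hence
`Hom_S(M, ω') ≅ Hom_R(M, ω)` by composition with `τ`, and since `S` is projective over `R` the
vanishing of `Ext_S(M, ω')` is that of `Ext_R(M, ω)` (`IsCoinduced.extVanishes_iff`).

The same happens over the endomorphism rings `T = End_R(ω)` and `E = End_S(ω')`. Central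
projectivity makes `ω'` a retract of some `ωⁿ` over `R` (`ExtensionOfScalars.isRetractOfPower`).
Composition with `τ` gives `E ≅ Hom_R(ω', ω)`, which is therefore a retract of `Tⁿ`, so that `E` is
projective over `T` (`IsCoinduced.end_projective`); and `ω'`, as a retract of `ωⁿ`, is reflexive,
which says `ω' ≅ Hom_T(Hom_R(ω', ω), ω) ≅ Hom_T(E, ω)`. So `ω'` is coinduced from `ω` along
`T → E`, with the same counit `τ` (`IsCoinduced.end_isCoinduced`). Applied to the `E`-module
`Hom_S(M, ω') ≅ Hom_R(M, ω)`, this gives the comparison of the `Ext` groups of the duals, and also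
an isomorphism of the biduals of `M` that carries one evaluation map to the other
(`IsCoinduced.evaluationMap_bijective_iff`).
-/

/-! ### Dimension shifting for Ext over a ring -/

open CategoryTheory in
theorem subsingleton_ext_one_iff {A : Type u} [Ring A] {K P N : Type u} [AddCommGroup K]
    [AddCommGroup P] [AddCommGroup N] [Module A K] [Module A P] [Module A N]
    [Module.Projective A P] (i : K →ₗ[A] P) (p : P →ₗ[A] N) (hi : Function.Injective i)
    (hip : Function.Exact i p) (hp : Function.Surjective p)
    (W : Type u) [AddCommGroup W] [Module A W] :
    Subsingleton (Abelian.Ext (ModuleCat.of A N) (ModuleCat.of A W) 1) ↔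
      ∀ g : K →ₗ[A] W, ∃ h : P →ₗ[A] W, h ∘ₗ i = g := by
  have hS := ModuleCat.shortComplex_shortExact
    (ModuleCat.shortComplexOfCompEqZero i p hip.linearMap_comp_eq_zero) hip hi hp
  have : Projective (ModuleCat.of A P) := (IsProjective.iff_projective P).1 inferInstance
  constructor
  · intro _ g
    obtain ⟨x, hx⟩ := Abelian.Ext.contravariant_sequence_exact₁ hS (ModuleCat.of A W)
      (Abelian.Ext.mk₀ (ModuleCat.ofHom g)) rfl (Subsingleton.elim _ _)
    obtain ⟨h, rfl⟩ := (Abelian.Ext.mk₀_bijective _ _).2 x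
    rw [Abelian.Ext.mk₀_comp_mk₀] at hx
    exact ⟨h.hom, congrArg ModuleCat.Hom.hom ((Abelian.Ext.mk₀_bijective _ _).1 hx)⟩
  · intro H
    refine subsingleton_of_forall_eq 0 fun x => ?_
    obtain ⟨y, rfl⟩ := Abelian.Ext.contravariant_sequence_exact₃ hS (ModuleCat.of A W) x
      (Abelian.Ext.eq_zero_of_projective _) (add_zero 1)
    obtain ⟨g, rfl⟩ := (Abelian.Ext.mk₀_bijective _ _).2 y
    obtain ⟨h, hh⟩ := H g.hom
    have hg : g = ModuleCat.ofHom i ≫ ModuleCat.ofHom h := by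
      ext1
      exact hh.symm
    rw [hg, ← Abelian.Ext.mk₀_comp_mk₀]
    exact hS.extClass_comp_assoc _

open CategoryTheory in
theorem subsingleton_ext_succ_succ_iff {A : Type u} [Ring A] {K P N : Type u} [AddCommGroup K]
    [AddCommGroup P] [AddCommGroup N] [Module A K] [Module A P] [Module A N]
    [Module.Projective A P] (i : K →ₗ[A] P) (p : P →ₗ[A] N) (hi : Function.Injective i)
    (hip : Function.Exact i p) (hp : Function.Surjective p)
    (W : Type u) [AddCommGroup W] [Module A W] (n : ℕ) :
    Subsingleton (Abelian.Ext (ModuleCat.of A N) (ModuleCat.of A W) (n + 2)) ↔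
      Subsingleton (Abelian.Ext (ModuleCat.of A K) (ModuleCat.of A W) (n + 1)) := by
  have hS := ModuleCat.shortComplex_shortExact
    (ModuleCat.shortComplexOfCompEqZero i p hip.linearMap_comp_eq_zero) hip hi hp
  have : Projective (ModuleCat.of A P) := (IsProjective.iff_projective P).1 inferInstance
  constructor
  · intro _
    refine subsingleton_of_forall_eq 0 fun x => ?_
    obtain ⟨y, rfl⟩ := Abelian.Ext.contravariant_sequence_exact₁ hS (ModuleCat.of A W) x
      (show 1 + (n + 1) = n + 2 by lia) (Subsingleton.elim _ _)
    rw [Abelian.Ext.eq_zero_of_projective y, Abelian.Ext.comp_zero]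
  · intro _
    refine subsingleton_of_forall_eq 0 fun x => ?_
    obtain ⟨y, rfl⟩ := Abelian.Ext.contravariant_sequence_exact₃ hS (ModuleCat.of A W) x
      (Abelian.Ext.eq_zero_of_projective _) (show 1 + (n + 1) = n + 2 by lia)
    have hy : y = 0 := Subsingleton.elim _ _
    rw [hy, Abelian.Ext.comp_zero]

/-! ### Coinduced modules -/

/-- The `B`-module `W'` is coinduced from the `A`-module `W` along `f : A → B`, with counit
`τ : W' → W`: the map `τ` is `A`-linear and `w ↦ (b ↦ τ (b • w))` is a bijection from `W'` to
`Hom_A(B, W)`. The `A`-module structures on `W'` and `B` are expressed through `f`. -/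
structure IsCoinduced {A B : Type u} [Ring A] [Ring B] (f : A →+* B) {W W' : Type u}
    [AddCommGroup W] [AddCommGroup W'] [Module A W] [Module B W'] (τ : W' →+ W) : Prop where
  apply_smul : ∀ (a : A) (w : W'), τ (f a • w) = a • τ w
  existsUnique : ∀ g : B →+ W, (∀ (a : A) (b : B), g (f a * b) = a • g b) →
    ∃! w : W', ∀ b : B, τ (b • w) = g b

namespace IsCoinduced

variable {A B : Type u} [Ring A] [Ring B] {f : A →+* B} {W W' : Type u}
    [AddCommGroup W] [AddCommGroup W'] [Module A W] [Module B W'] {τ : W' →+ W}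

theorem ext (h : IsCoinduced f τ) {w w' : W'} (hw : ∀ b : B, τ (b • w) = τ (b • w')) :
    w = w' := by
  refine (h.existsUnique (τ.comp (smulAddHom B W' |>.flip w')) fun a b => ?_).unique hw
    fun _ => rfl
  simp [mul_smul, h.apply_smul]

variable {N N' : Type u} [AddCommGroup N] [AddCommGroup N'] [Module B N] [Module A N']

theorem linearMap_ext (h : IsCoinduced f τ) {k k' : N →ₗ[B] W'}
    (hk : ∀ x, τ (k x) = τ (k' x)) : k = k' := by
  ext x
  refine h.ext fun b => ?_
  simpa using hk (b • x)

/-- The universal property of a coinduced module. The isomorphism `θ` identifies `N'` with the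
restriction of the `B`-module `N` to `A`. -/
theorem exists_lift (h : IsCoinduced f τ) (θ : N' ≃+ N)
    (hθ : ∀ (a : A) (x : N'), θ (a • x) = f a • θ x) (g : N' →ₗ[A] W) :
    ∃ k : N →ₗ[B] W', ∀ x, τ (k (θ x)) = g x := by
  have H : ∀ x : N, ∃ w : W', ∀ b : B, τ (b • w) = g (θ.symm (b • x)) := fun x => by
    refine (h.existsUnique
      (g.toAddMonoidHom.comp (θ.symm.toAddMonoidHom.comp ((smulAddHom B N).flip x))) ?_).exists
    intro a b
    have : θ.symm (f a • b • x) = a • θ.symm (b • x) := by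
      rw [AddEquiv.symm_apply_eq, hθ, AddEquiv.apply_symm_apply]
    simp [mul_smul, this]
  choose k hk using H
  refine ⟨{ toFun := k, map_add' := fun x y => h.ext fun b => ?_,
            map_smul' := fun c x => h.ext fun b => ?_ }, fun x => ?_⟩
  · simp [hk]
  · rw [hk, RingHom.id_apply, ← mul_smul b c (k x), hk, mul_smul]
  · have := hk (θ x) 1
    rwa [one_smul, one_smul, AddEquiv.symm_apply_apply] at this

/-- The adjunction isomorphism `Hom_B(N, W') ≃ Hom_A(N', W)`, `k ↦ τ ∘ k ∘ θ`, where `θ` identifies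
`N'` with the restriction of `N` to `A`. -/
noncomputable def homEquiv (h : IsCoinduced f τ) (θ : N' ≃+ N)
    (hθ : ∀ (a : A) (x : N'), θ (a • x) = f a • θ x) : (N →ₗ[B] W') ≃+ (N' →ₗ[A] W) :=
  AddEquiv.ofBijective
    ({
      toFun := fun k =>
        { toFun := fun x => τ (k (θ x))
          map_add' := fun x y => by simp
          map_smul' := fun a x => by simp [hθ, h.apply_smul] }
      map_zero' := by ext; simp
      map_add' := fun k k' => by ext; simp } : (N →ₗ[B] W') →+ (N' →ₗ[A] W))
    ⟨fun k k' hk => h.linearMap_ext fun x => by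
        simpa using LinearMap.congr_fun hk (θ.symm x),
      fun g => (h.exists_lift θ hθ g).imp fun _ hk => LinearMap.ext hk⟩

@[simp]
theorem homEquiv_apply (h : IsCoinduced f τ) (θ : N' ≃+ N)
    (hθ : ∀ (a : A) (x : N'), θ (a • x) = f a • θ x) (k : N →ₗ[B] W') (x : N') :
    h.homEquiv θ hθ k x = τ (k (θ x)) := rfl

theorem forall_extends_iff (h : IsCoinduced f τ) {K P : Type u} [AddCommGroup K] [AddCommGroup P]
    [Module A K] [Module B K] [Module A P] [Module B P] (hK : ∀ (a : A) (x : K), a • x = f a • x)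
    (hP : ∀ (a : A) (x : P), a • x = f a • x) (i : K →ₗ[B] P) (i' : K →ₗ[A] P)
    (hi : ∀ x, i x = i' x) :
    (∀ g : K →ₗ[B] W', ∃ k : P →ₗ[B] W', k ∘ₗ i = g) ↔
      ∀ g : K →ₗ[A] W, ∃ k : P →ₗ[A] W, k ∘ₗ i' = g := by
  constructor
  · intro H g
    obtain ⟨k, hk⟩ := h.exists_lift (AddEquiv.refl K) hK g
    obtain ⟨k', rfl⟩ := H k
    exact ⟨h.homEquiv (AddEquiv.refl P) hP k', LinearMap.ext fun x =>
      (congrArg (fun y => τ (k' y)) (hi x)).symm.trans (hk x)⟩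
  · intro H g
    obtain ⟨k, hk⟩ := H (h.homEquiv (AddEquiv.refl K) hK g)
    obtain ⟨k', hk'⟩ := h.exists_lift (AddEquiv.refl P) hP k
    refine ⟨k', h.linearMap_ext fun x => ?_⟩
    rw [LinearMap.comp_apply, hi]
    exact (hk' _).trans (LinearMap.congr_fun hk x)

/-- Shapiro's lemma, in the form of a comparison of vanishing: as `B` is projective over `A`, a free
presentation of `N` over `B` restricts to a projective presentation over `A`, and dimension
shifting over both rings reduces to the extension of homomorphisms to `W'` and to `W`. -/
theorem subsingleton_ext_iff (h : IsCoinduced f τ) [Module A B] [Module.Projective A B]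
    (hAB : ∀ (a : A) (b : B), a • b = f a * b) (n : ℕ) {N N' : Type u} [AddCommGroup N]
    [AddCommGroup N'] [Module B N] [Module A N'] (θ : N' ≃+ N)
    (hθ : ∀ (a : A) (x : N'), θ (a • x) = f a • θ x) :
    Subsingleton (CategoryTheory.Abelian.Ext (ModuleCat.of B N) (ModuleCat.of B W') (n + 1)) ↔
      Subsingleton
        (CategoryTheory.Abelian.Ext (ModuleCat.of A N') (ModuleCat.of A W) (n + 1)) := by
  let p : (N →₀ B) →ₗ[B] N := Finsupp.linearCombination B id
  have hp : Function.Surjective p := Finsupp.linearCombination_id_surjective B N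
  have hP (a : A) (x : N →₀ B) : a • x = f a • x := by
    ext
    simp [hAB]
  have : Module.Projective A (N →₀ B) := by
    classical
    exact Module.Projective.of_equiv' (finsuppLequivDFinsupp (M := B) (ι := N) A).symm
  let : Module A (LinearMap.ker p) := Module.compHom _ f
  have hK (a : A) (x : LinearMap.ker p) : a • x = f a • x := rfl
  let i' : LinearMap.ker p →ₗ[A] (N →₀ B) :=
    { toFun := fun x => x
      map_add' := fun _ _ => rfl
      map_smul' := fun a x => (hP a x).symm }
  let p' : (N →₀ B) →ₗ[A] N' :=
    { toFun := fun x => θ.symm (p x)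
      map_add' := fun x y => by simp
      map_smul' := fun a x => by
        rw [AddEquiv.symm_apply_eq, RingHom.id_apply, hθ, AddEquiv.apply_symm_apply, hP, map_smul] }
  let i : LinearMap.ker p →ₗ[B] (N →₀ B) := (LinearMap.ker p).subtype
  have hi : Function.Injective i := Subtype.val_injective
  have hi' : Function.Injective i' := Subtype.val_injective
  have hp' : Function.Surjective p' := θ.symm.surjective.comp hp
  have hip : Function.Exact i p := p.exact_subtype_ker_map
  have hip' : Function.Exact i' p' := fun x =>
    (AddEquiv.map_eq_zero_iff θ.symm).trans (hip x)
  cases n with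
  | zero =>
    rw [zero_add, subsingleton_ext_one_iff (A := B) (K := LinearMap.ker p) i p hi hip hp,
      subsingleton_ext_one_iff (K := LinearMap.ker p) i' p' hi' hip' hp']
    exact h.forall_extends_iff (K := LinearMap.ker p) (P := N →₀ B) hK hP i i' fun _ => rfl
  | succ n =>
    rw [subsingleton_ext_succ_succ_iff (A := B) (K := LinearMap.ker p) i p hi hip hp,
      subsingleton_ext_succ_succ_iff (K := LinearMap.ker p) i' p' hi' hip' hp']
    exact h.subsingleton_ext_iff hAB n (AddEquiv.refl (LinearMap.ker p)) hK

theorem extVanishes_iff (h : IsCoinduced f τ) [Module A B] [Module.Projective A B]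
    (hAB : ∀ (a : A) (b : B), a • b = f a * b) (θ : N' ≃+ N)
    (hθ : ∀ (a : A) (x : N'), θ (a • x) = f a • θ x) :
    ExtVanishes B N W' ↔ ExtVanishes A N' W := by
  refine forall₂_congr fun i hi => ?_
  obtain ⟨n, rfl⟩ := Nat.exists_eq_add_of_le' hi
  exact h.subsingleton_ext_iff hAB n θ hθ

end IsCoinduced

/-! ### Passing to endomorphism rings -/

/-- The `R`-module `W'` is a direct summand of `Wⁿ` for some `n`, expressed as a finite family of
maps `W' → W → W'` whose composites sum to the identity. -/
def IsRetractOfPower (R : Type u) [Ring R] (W' W : Type u) [AddCommGroup W'] [Module R W']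
    [AddCommGroup W] [Module R W] : Prop :=
  ∃ (n : ℕ) (u : Fin n → W' →ₗ[R] W) (v : Fin n → W →ₗ[R] W'), ∀ w, ∑ j, v j (u j w) = w

namespace IsCoinduced

variable {R S : Type u} [Ring R] [Ring S] {l : R →+* S} {W W' : Type u}
    [AddCommGroup W] [AddCommGroup W'] [Module R W] [Module S W'] {τ : W' →+ W}

/-- An endomorphism `t` of `W` induces the endomorphism of the coinduced module `W'` that
corresponds to `t ∘ τ`; this is a ring homomorphism `End_R(W) → End_S(W')`. -/
theorem exists_endHom (h : IsCoinduced l τ) :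
    ∃ f : Module.End R W →+* Module.End S W', ∀ t w, τ (f t w) = t (τ w) := by
  let : Module R W' := Module.compHom W' l
  let τ' : W' →ₗ[R] W := { τ with map_smul' := h.apply_smul }
  have H (t : Module.End R W) : ∃ e : Module.End S W', ∀ w, τ (e w) = t (τ w) :=
    h.exists_lift (AddEquiv.refl W') (fun _ _ => rfl) (t ∘ₗ τ')
  choose f hf using H
  exact ⟨{ toFun := f
           map_one' := h.linearMap_ext fun w => by simp [hf]
           map_mul' := fun s t => h.linearMap_ext fun w => by simp [hf]
           map_zero' := h.linearMap_ext fun w => by simp [hf]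
           map_add' := fun s t => h.linearMap_ext fun w => by simp [hf] }, hf⟩

variable [Module R W'] (hW' : ∀ (r : R) (w : W'), r • w = l r • w)
include hW'

/-- If `W'` is a retract of `Wⁿ`, then composition with `τ` identifies `End_S(W')` with
`Hom_R(W', W)`, a retract of `End_R(W)ⁿ`: the `e j` form a dual basis of `End_S(W')` over
`End_R(W)` with coordinate functions `c j`. -/
theorem exists_endRetraction (h : IsCoinduced l τ) (hr : IsRetractOfPower R W' W)
    {f : Module.End R W →+* Module.End S W'} (hf : ∀ t w, τ (f t w) = t (τ w)) :
    ∃ (n : ℕ) (e : Fin n → Module.End S W') (v : Fin n → W →ₗ[R] W')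
      (c : Fin n → Module.End S W' → Module.End R W),
      (∀ w, ∑ j, v j (τ (e j w)) = w) ∧ (∀ j b w, c j b w = τ (b (v j w))) ∧
      ∀ b, ∑ j, f (c j b) * e j = b := by
  obtain ⟨n, u, v, huv⟩ := hr
  have H (j : Fin n) : ∃ e : Module.End S W', ∀ w, τ (e w) = u j w :=
    h.exists_lift (AddEquiv.refl W') hW' (u j)
  choose e he using H
  refine ⟨n, e, v, fun j b => h.homEquiv (AddEquiv.refl W') hW' b ∘ₗ v j, fun w => ?_,
    fun j b w => rfl, fun b => h.linearMap_ext fun w => ?_⟩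
  · simp [he, huv]
  · simp only [LinearMap.sum_apply, Module.End.mul_apply, map_sum, hf, LinearMap.comp_apply,
      he]
    rw [← map_sum, huv]
    rfl

/-- The module `W'` is also coinduced from `W` along `End_R(W) → End_S(W')`, by the same `τ`:
retracts of `Wⁿ` are reflexive, so `W'` is the `End_R(W)`-dual of `Hom_R(W', W) ≅ End_S(W')`. -/
theorem end_isCoinduced (h : IsCoinduced l τ) (hr : IsRetractOfPower R W' W)
    {f : Module.End R W →+* Module.End S W'} (hf : ∀ t w, τ (f t w) = t (τ w)) :
    IsCoinduced f τ := by
  obtain ⟨n, e, v, c, hev, hc, hce⟩ := h.exists_endRetraction hW' hr hf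
  refine ⟨hf, fun g hg => ⟨∑ j, v j (g (e j)), fun b => ?_, fun w hw => ?_⟩⟩
  · conv_rhs => rw [← hce b]
    simp [hg, hc]
  · simp only [Module.End.smul_def] at hw
    rw [← hev w]
    simp [hw]

theorem end_projective (h : IsCoinduced l τ) (hr : IsRetractOfPower R W' W)
    {f : Module.End R W →+* Module.End S W'} (hf : ∀ t w, τ (f t w) = t (τ w))
    [Module (Module.End R W) (Module.End S W')]
    (hTE : ∀ (t : Module.End R W) (b : Module.End S W'), t • b = f t * b) :
    Module.Projective (Module.End R W) (Module.End S W') := by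
  obtain ⟨n, e, v, c, hev, hc, hce⟩ := h.exists_endRetraction hW' hr hf
  refine .of_split (M := Fin n → Module.End R W)
    { toFun := fun b j => c j b
      map_add' := fun b b' => by
        ext j w
        simp [hc]
      map_smul' := fun t b => by
        ext j w
        simp [hc, hTE, hf] }
    { toFun := fun t => ∑ j, f (t j) * e j
      map_add' := fun t t' => by simp [add_mul, Finset.sum_add_distrib]
      map_smul' := fun t t' => by simp [hTE, Finset.mul_sum, mul_assoc] }
    (LinearMap.ext hce)

omit hW' [Module R W'] in
theorem homEquiv_symm_smul (h : IsCoinduced l τ)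
    {f : Module.End R W →+* Module.End S W'} (hf : ∀ t w, τ (f t w) = t (τ w))
    {M M' : Type u} [AddCommGroup M] [AddCommGroup M'] [Module S M] [Module R M'] (θ : M' ≃+ M)
    (hθ : ∀ (r : R) (x : M'), θ (r • x) = l r • θ x) (t : Module.End R W) (k : M' →ₗ[R] W) :
    (h.homEquiv θ hθ).symm (t • k) = f t • (h.homEquiv θ hθ).symm k := by
  rw [AddEquiv.symm_apply_eq]
  ext x
  have : τ ((h.homEquiv θ hθ).symm k (θ x)) = k x :=
    LinearMap.congr_fun ((h.homEquiv θ hθ).apply_symm_apply k) x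
  simp [hf, this]

omit hW' [Module R W'] in
/-- Under the adjunction isomorphisms `Hom_S(M, W') ≅ Hom_R(M', W)` and
`Hom_E(Hom_S(M, W'), W') ≅ Hom_T(Hom_R(M', W), W)`, where `E = End_S(W')` and `T = End_R(W)`, the
two evaluation maps correspond to each other. -/
theorem evaluationMap_bijective_iff (h : IsCoinduced l τ)
    {f : Module.End R W →+* Module.End S W'} (hf : ∀ t w, τ (f t w) = t (τ w))
    (hE : IsCoinduced f τ) {M M' : Type u} [AddCommGroup M] [AddCommGroup M']
    [Module S M] [Module R M'] (θ : M' ≃+ M) (hθ : ∀ (r : R) (x : M'), θ (r • x) = l r • θ x) :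
    Function.Bijective (evaluationMap S W' M) ↔ Function.Bijective (evaluationMap R W M') := by
  let η := h.homEquiv θ hθ
  let ζ := hE.homEquiv η.symm (h.homEquiv_symm_smul hf θ hθ)
  have : ⇑(evaluationMap R W M') = ζ ∘ evaluationMap S W' M ∘ θ := by
    funext x
    ext k
    exact (LinearMap.congr_fun (η.apply_symm_apply k) x).symm
  rw [this, EquivLike.comp_bijective (f := _) (e := ζ), Function.Bijective.of_comp_iff _ θ.bijective]

/-- Generalized G-dimension zero with respect to a coinduced module that is a retract of a power
of the original one can be tested after restriction of scalars. -/
theorem hasGeneralizedGDimZero_iff (h : IsCoinduced l τ) (hr : IsRetractOfPower R W' W)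
    {M : Type u} [AddCommGroup M] [Module S M] [Module R M] [Module R S] [IsScalarTower R S M]
    [Module.Finite R S] [Module.Projective R S] (hRS : ∀ (r : R) (s : S), r • s = l r * s) :
    HasGeneralizedGDimZero S W' M ↔ HasGeneralizedGDimZero R W M := by
  have hM (r : R) (x : M) : r • x = l r • x := by
    rw [← mul_one (l r), ← hRS, smul_assoc, one_smul]
  obtain ⟨f, hf⟩ := h.exists_endHom
  have hE := h.end_isCoinduced hW' hr hf
  let : Module (Module.End R W) (Module.End S W') := Module.compHom _ f
  have hTE (t : Module.End R W) (b : Module.End S W') : t • b = f t * b := rfl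
  have := h.end_projective hW' hr hf hTE
  have hfin : Module.Finite S M ↔ Module.Finite R M :=
    ⟨fun _ => Module.Finite.trans S M, fun _ => Module.Finite.of_restrictScalars_finite R S M⟩
  have hev := h.evaluationMap_bijective_iff hf hE (AddEquiv.refl M) hM
  have hl := h.extVanishes_iff hRS (AddEquiv.refl M) hM
  let η := h.homEquiv (AddEquiv.refl M) hM
  have hright : ExtVanishes (Module.End S W') (M →ₗ[S] W') W' ↔
      ExtVanishes (Module.End R W) (M →ₗ[R] W) W :=
    hE.extVanishes_iff hTE η.symm (h.homEquiv_symm_smul hf (AddEquiv.refl M) hM)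
  exact ⟨fun H => ⟨hfin.1 H.1, hev.1 H.2, hl.1 H.3, hright.1 H.4⟩,
    fun H => ⟨hfin.2 H.1, hev.2 H.2, hl.2 H.3, hright.2 H.4⟩⟩

end IsCoinduced

/-! ### Extension of scalars along a Frobenius extension -/

namespace ExtensionOfScalars

variable {R S : Type u} [Ring R] [Ring S] (l : R →+* S) (W : Type u) [AddCommGroup W] [Module R W]

/-- The biadditive map `(s, w) ↦ s ⊗ w` from `S × W` to `S ⊗_R W`. -/
def tmul : S →+ W →+ ExtensionOfScalars l W :=
  AddMonoidHom.mk' (fun s => AddMonoidHom.mk' (fun w => Submodule.Quotient.mk (s ⊗ₜ[ℤ] w))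
      fun w w' => by rw [TensorProduct.tmul_add, Submodule.Quotient.mk_add])
    fun s s' => by
      ext w
      simp [TensorProduct.add_tmul]

variable {W}

theorem smul_tmul (s s' : S) (w : W) : s • tmul l W s' w = tmul l W (s * s') w := rfl

theorem tmul_smul (s : S) (r : R) (w : W) : tmul l W s (r • w) = tmul l W (s * l r) w := by
  refine ((Submodule.Quotient.eq _).2 (Submodule.subset_span ?_)).symm
  exact ⟨s, r, w, rfl⟩

variable {l}

@[elab_as_elim]
theorem induction {motive : ExtensionOfScalars l W → Prop} (zero : motive 0)
    (tmul : ∀ s w, motive (tmul l W s w)) (add : ∀ x y, motive x → motive y → motive (x + y))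
    (x : ExtensionOfScalars l W) : motive x := by
  induction x using Submodule.Quotient.induction_on with
  | _ x =>
    induction x using TensorProduct.induction_on with
    | zero => exact zero
    | tmul s w => exact tmul s w
    | add x y hx hy => exact add _ _ hx hy

/-- A biadditive map that is balanced over `R` factors through `S ⊗_R W`. Since the relations span
an `S`-submodule, the induced map on `S ⊗_ℤ W` has to kill all `S`-multiples of them, which are
again relations. -/
theorem exists_lift {X : Type u} [AddCommGroup X] (β : S →+ W →+ X)
    (hβ : ∀ s r w, β (s * l r) w = β s (r • w)) :
    ∃ L : ExtensionOfScalars l W →+ X, ∀ s w, L (tmul l W s w) = β s w := by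
  let L₀ : S ⊗[ℤ] W →+ X := TensorProduct.liftAddHom β fun n s w => by
    rw [map_zsmul, map_zsmul]
    rfl
  have hL₀ (s : S) (w : W) : L₀ (s ⊗ₜ w) = β s w := rfl
  let I := Submodule.span S
    {x : S ⊗[ℤ] W | ∃ (s : S) (r : R) (w : W), x = (s * l r) ⊗ₜ[ℤ] w - s ⊗ₜ[ℤ] (r • w)}
  have key (x : S ⊗[ℤ] W) (hx : x ∈ I) : ∀ t : S, L₀ (t • x) = 0 := by
    induction hx using Submodule.span_induction with
    | mem x hx =>
      obtain ⟨s, r, w, rfl⟩ := hx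
      intro t
      rw [smul_sub, map_sub, TensorProduct.smul_tmul', TensorProduct.smul_tmul', hL₀, hL₀,
        smul_eq_mul, smul_eq_mul, ← mul_assoc, hβ, sub_self]
    | zero => simp
    | add x y _ _ hx hy => simp [hx, hy]
    | smul c x _ hx => exact fun t => by rw [← mul_smul, hx]
  exact ⟨QuotientAddGroup.lift I.toAddSubgroup L₀ fun x hx => by simpa using key x hx 1,
    fun s w => hL₀ s w⟩

/-- For a Frobenius extension with Frobenius homomorphism `tr = φ 1 : S → R`, the `S`-module
`S ⊗_R W` is coinduced from `W` along `s ⊗ w ↦ tr(s) w`. -/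
theorem exists_isCoinduced (hl : IsFrobeniusExtension l) :
    ∃ τ : ExtensionOfScalars l W →+ W, IsCoinduced l τ := by
  let : Module R S := Module.compHom S l
  obtain ⟨_, _, φ, hφ, hφ'⟩ := hl
  have hRS (r : R) (s : S) : r • s = l r * s := rfl
  obtain ⟨n, π, hπ⟩ := Module.Finite.exists_fin' R S
  obtain ⟨σ, hσ⟩ := Module.projective_lifting_property π LinearMap.id hπ
  have hφ₁ (s x : S) : φ s x = φ 1 (x * s) := by rw [← hφ, mul_one]
  have htr (s : S) (r : R) : φ 1 (s * l r) = φ 1 s * r := by rw [← hφ', one_mul, ← hφ₁]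
  -- A pair of dual bases `x`, `y` for the Frobenius form `(s, t) ↦ tr(s t)`.
  let x (i : Fin n) : S := π (Pi.single i 1)
  let y (i : Fin n) : S := φ.symm (LinearMap.proj i ∘ₗ σ)
  have hxy (s : S) : ∑ i, l (φ 1 (s * y i)) * x i = s := by
    have h (i : Fin n) : l (φ 1 (s * y i)) * x i = π (Pi.single i (σ s i)) := by
      rw [← hφ₁, AddEquiv.apply_symm_apply, ← hRS, ← map_smul, ← Pi.single_smul', smul_eq_mul,
        mul_one]
      rfl
    rw [Finset.sum_congr rfl fun i _ => h i, ← map_sum, Finset.univ_sum_single]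
    exact LinearMap.congr_fun hσ s
  have hyx (s : S) : ∑ i, y i * l (φ 1 (x i * s)) = s := by
    refine φ.injective (LinearMap.ext fun t => ?_)
    rw [hφ₁, hφ₁ s]
    conv_rhs => rw [← hxy t, Finset.sum_mul, map_sum]
    simp only [Finset.mul_sum, map_sum, ← mul_assoc, htr]
    refine Finset.sum_congr rfl fun i _ => ?_
    rw [mul_assoc, ← hRS, map_smul, smul_eq_mul]
  obtain ⟨τ, hτ⟩ := exists_lift (l := l) (W := W)
    ((smulAddHom R W).comp (φ 1).toAddMonoidHom) fun s r w => by simp [htr, mul_smul]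
  replace hτ (s : S) (w : W) : τ (tmul l W s w) = φ 1 s • w := hτ s w
  refine ⟨τ, fun r w => ?_, fun g hg => ⟨∑ i, tmul l W (y i) (g (x i)), fun b => ?_,
    fun w hw => ?_⟩⟩
  · induction w using ExtensionOfScalars.induction with
    | zero => simp
    | tmul s w => rw [smul_tmul, hτ, hτ, ← hRS, map_smul, smul_eq_mul, mul_smul]
    | add x y hx hy => simp only [smul_add, map_add, hx, hy]
  · conv_rhs => rw [← hxy b]
    simp only [Finset.smul_sum, smul_tmul, map_sum, hτ, hg]
  · simp only [← hw]
    clear hw hg g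
    symm
    induction w using ExtensionOfScalars.induction with
    | zero => simp
    | tmul s w =>
      conv_rhs => rw [← hyx s]
      simp only [smul_tmul, hτ, tmul_smul, map_sum, AddMonoidHom.finsetSum_apply]
    | add x y hx hy => simp only [smul_add, map_add, Finset.sum_add_distrib, hx, hy]

/-- If `S` is a retract of `Rⁿ` as a bimodule, then `S ⊗_R W` is a retract of `Wⁿ` over `R`. -/
theorem isRetractOfPower (hc : IsCentrallyProjective l) [Module R (ExtensionOfScalars l W)]
    (hW : ∀ (r : R) (w : ExtensionOfScalars l W), r • w = l r • w) :
    IsRetractOfPower R (ExtensionOfScalars l W) W := by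
  obtain ⟨n, i, p, hi, hp, hpi⟩ := hc
  -- The images of the standard basis commute with `R`, so `w ↦ a j ⊗ w` is `R`-linear.
  let a (j : Fin n) : S := p (Pi.single j 1)
  have ha (j : Fin n) (r : R) : a j * l r = p (Pi.single j r) := by
    have := hp 1 r (Pi.single j 1)
    rw [map_one, one_mul] at this
    rw [← this]
    congr 1
    ext k
    by_cases hk : k = j
    · subst hk
      simp
    · simp [hk]
  have ha' (j : Fin n) (r : R) : l r * a j = p (Pi.single j r) := by
    have := hp r 1 (Pi.single j 1)
    rw [map_one, mul_one] at this
    rw [← this]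
    congr 1
    ext k
    by_cases hk : k = j
    · subst hk
      simp
    · simp [hk]
  have hil (r : R) (s : S) (j : Fin n) : i (l r * s) j = r * i s j := by
    simpa using hi r 1 s j
  have hir (s : S) (r : R) (j : Fin n) : i (s * l r) j = i s j * r := by
    simpa using hi 1 r s j
  have H (j : Fin n) := exists_lift (l := l) (W := W)
    ((smulAddHom R W).comp ((Pi.evalAddMonoidHom _ j).comp i))
    fun s r w => by simp [hir, mul_smul]
  choose u hu using H
  replace hu (j : Fin n) (s : S) (w : W) : u j (tmul l W s w) = i s j • w := hu j s w
  refine ⟨n, fun j => { u j with map_smul' := fun r w => ?_ },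
    fun j => { tmul l W (a j) with map_smul' := fun r w => ?_ }, fun w => ?_⟩
  · change u j (r • w) = r • u j w
    rw [hW]
    induction w using ExtensionOfScalars.induction with
    | zero => simp
    | tmul s w => rw [smul_tmul, hu, hu, hil, mul_smul]
    | add x y hx hy => simp only [smul_add, map_add, hx, hy]
  · change tmul l W (a j) (r • w) = r • tmul l W (a j) w
    rw [hW, smul_tmul, tmul_smul, ha, ha']
  · change ∑ j, tmul l W (a j) (u j w) = w
    induction w using ExtensionOfScalars.induction with
    | zero => simp
    | tmul s w =>
      simp only [hu, tmul_smul, ha]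
      rw [← AddMonoidHom.finsetSum_apply, ← map_sum, ← map_sum, Finset.univ_sum_single, hpi]
    | add x y hx hy => simp only [map_add, Finset.sum_add_distrib, hx, hy]

end ExtensionOfScalars

/-! ### Transfer of generalized G-dimension zero along the extension -/

theorem theorem5p6 {R S : Type u} [Ring R] [Ring S]
    (hR : IsTwoSidedNoetherian R) (hS : IsTwoSidedNoetherian S)
    (l : R →+* S) (hl : IsFrobeniusExtension l) (hc : IsCentrallyProjective l)
    (ω : Type u) [AddCommGroup ω] [Module R ω] (hω : IsWakamatsuTilting R ω)
    (M : Type u) [AddCommGroup M] [Module S M] :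
    HasGeneralizedGDimZero S (ExtensionOfScalars l ω) M ↔
      HasGeneralizedGDimZero R ω ((ModuleCat.restrictScalars l).obj (ModuleCat.of S M)) := by
  let : Module R S := Module.compHom S l
  let : Module R M := Module.compHom M l
  let : Module R (ExtensionOfScalars l ω) := Module.compHom _ l
  have : IsScalarTower R S M := ⟨fun r s x => mul_smul (l r) s x⟩
  obtain ⟨τ, hτ⟩ := ExtensionOfScalars.exists_isCoinduced (W := ω) hl
  have hr := ExtensionOfScalars.isRetractOfPower (W := ω) hc fun _ _ => rfl
  obtain ⟨_, _, -⟩ := hl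
  exact hτ.hasGeneralizedGDimZero_iff (fun _ _ => rfl) hr (M := M) fun _ _ => rfl
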